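/- Let $H=(V,E,w)$ be a finite hypergraph with at least one edge, whose edges are nonempty subsets of $V$ and whose weights $w(e)$ are positive. Put $\deg(v)=\sum_{e\ni v}w(e)$, $D_H=\mathrm{diag}(\deg)$ and $\|f\|_w^2=f^{\top}D_Hf$ for $f\in\mathbb{R}^V$. For $e\in E$ let $\Delta_f(e)=\max_{u\in e}f(u)+\min_{v\in e}f(v)$, let $S_f(e)$ and $I_f(e)$ be the sets of those $v\in e$ at which $f|_e$ is maximal and minimal, respectively, and let $$D(f)=\frac{\sum_{e\in E}w(e)\,\Delta_f(e)^2}{\|f\|_w^2}\qquad(\|f\|_w\neq 0).$$ The operator $J_H:\mathbb{R}^V\to\mathbb{R}^V$ is defined by $J_Hf=-D_Hr$, where $r\in\mathbb{R}^V$ is the rate of change of the diffusion at $f$: the unique vector for which there are reals $r^S_e(v),r^I_e(v)$ ($e\in E$, $v\in V$) with $r(v)=\sum_{e}(r^S_e(v)+r^I_e(v))$ such that, for every $e$, 0. $r^S_e$ vanishes outside $S_f(e)$ and $r^I_e$ vanishes outside $I_f(e)$; both vanish identically if $\Delta_f(e)=0$; 1. $\sum_{v\in S_f(e)}\deg(v)r^S_e(v)=\sum_{v\in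 I_f(e)}\deg(v)r^I_e(v)=-w(e)\Delta_f(e)$; 2. (a) if $\Delta_f(e)>0$, then $r^S_e\le 0$, and $r(u)=\max_{S_f(e)}r$ for every $u\in S_f(e)$ with $r^S_e(u)\ne0$; if $\Delta_f(e)<0$ and $r^S_e(u)\neq 0$ for some $u\in S_f(e)$, then $r(u)=r(v)$ for all $v\in S_f(e)$; (b) if $\Delta_f(e)<0$, then $r^I_e\ge 0$, and $r(u)=\min_{I_f(e)}r$ for every $u\in I_f(e)$ with $r^I_e(u)\ne0$; if $\Delta_f(e)>0$ and $r^I_e(u)\neq 0$ for some $u\in I_f(e)$, then $r(u)=r(v)$ for all $v\in I_f(e)$. (Such an $r$ exists and is unique for every $f$.) Call $(\lambda,f)$ an eigen-pair, $\lambda$ an eigenvalue and $f$ an eigenvector of $J_H$ if $\|f\|_w\ne0$ and $J_Hf=\lambda D_Hf$; when all degrees are positive this means $f\neq 0$ and $D_H^{-1}J_Hf=\lambda f$. **Lemma.** The minimum $\gamma_1=\min_{f:\,\|f\|_w\neq0}D(f)$ is attained and is an eigenvalue of $J_H$, and every $f$ with $\|f\|_w\neq0$ and $D(f)=\gamma_1$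 is an eigenvector of $J_H$ with eigenvalue $\gamma_1$. -/

import Mathlib

open scoped Matrix

/-- A finite hypergraph on the vertex set `V` with positive edge weights. Edges are nonempty sets
of vertices (so that the maximum and the minimum of a vector over an edge make sense). -/
structure WeightedHypergraph (V : Type*) where
  edges : Finset (Finset V)
  weight : edges → ℝ
  edge_nonempty : ∀ e : edges, (e : Finset V).Nonempty
  weight_pos : ∀ e : edges, 0 < weight e

namespace WeightedHypergraph

section Basic

variable {V : Type*} [Fintype V] [DecidableEq V] (H : WeightedHypergraph V)

/-- The degree `deg(v) = ∑ₑ w(e) [v ∈ e]`. -/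
def deg (v : V) : ℝ := ∑ e : H.edges, if v ∈ (e : Finset V) then H.weight e else 0

/-- The diagonal matrix `D_H` of the degrees. -/
def degMatrix : Matrix V V ℝ := Matrix.diagonal H.deg

/-- The squared weighted norm `‖f‖_w² = fᵀ D_H f`. -/
def wNormSq (f : V → ℝ) : ℝ := f ⬝ᵥ (H.degMatrix *ᵥ f)

/-- `max_{u ∈ e} f(u)`. -/
def edgeMax (f : V → ℝ) (e : H.edges) : ℝ := (e : Finset V).sup' (H.edge_nonempty e) f

/-- `min_{u ∈ e} f(u)`. -/
def edgeMin (f : V → ℝ) (e : H.edges) : ℝ := (e : Finset V).inf' (H.edge_nonempty e) f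

/-- The discrepancy `Δ_f(e) = max_{u ∈ e} f(u) + min_{v ∈ e} f(v)`. -/
def disc (f : V → ℝ) (e : H.edges) : ℝ := H.edgeMax f e + H.edgeMin f e

/-- The discrepancy ratio `D(f) = (∑ₑ w(e) Δ_f(e)²) / ‖f‖_w²`. -/
noncomputable def discRatio (f : V → ℝ) : ℝ :=
  (∑ e : H.edges, H.weight e * H.disc f e ^ 2) / H.wNormSq f

/-- `S_f(e)`, the vertices of `e` at which `f` is maximal on `e`. -/
noncomputable def maxSet (f : V → ℝ) (e : H.edges) : Finset V :=
  {v ∈ (e : Finset V) | f v = H.edgeMax f e}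

/-- `I_f(e)`, the vertices of `e` at which `f` is minimal on `e`. -/
noncomputable def minSet (f : V → ℝ) (e : H.edges) : Finset V :=
  {v ∈ (e : Finset V) | f v = H.edgeMin f e}

/-- The rules of the diffusion at `f`. Here `rS e v` and `rI e v` are the contributions of the edge
`e` to the rate of change `r v` that `v` receives as a member of `S_f(e)` and of `I_f(e)`
respectively (so `r_e(v) = rS e v + rI e v`; if `f` is not constant on `e`, at most one of the two
terms is nonzero). -/
structure IsDiffusion (f r : V → ℝ) (rS rI : H.edges → V → ℝ) : Prop where
  /-- only the vertices of `S_f(e)` and `I_f(e)` take part in the diffusion along `e` -/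
  supp_S : ∀ e, ∀ v ∉ H.maxSet f e, rS e v = 0
  supp_I : ∀ e, ∀ v ∉ H.minSet f e, rI e v = 0
  /-- the rate of change is the sum of the contributions of the edges -/
  rate : ∀ v, r v = ∑ e : H.edges, (rS e v + rI e v)
  /-- Rule 1: the total contribution of `e` to each of `S_f(e)` and `I_f(e)` is `-w(e) Δ_f(e)` -/
  total_S : ∀ e, ∑ v ∈ H.maxSet f e, H.deg v * rS e v = -(H.weight e * H.disc f e)
  total_I : ∀ e, ∑ v ∈ H.minSet f e, H.deg v * rI e v = -(H.weight e * H.disc f e)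
  /-- edges of discrepancy zero do not contribute -/
  zero_S : ∀ e, H.disc f e = 0 → ∀ v, rS e v = 0
  zero_I : ∀ e, H.disc f e = 0 → ∀ v, rI e v = 0
  /-- Rule 2a, positive discrepancy: the vertices of `S_f(e)` can only lose, and only those with
  the largest rate of change take part -/
  pos_S_sign : ∀ e, 0 < H.disc f e → ∀ v, rS e v ≤ 0
  pos_S : ∀ e, 0 < H.disc f e → ∀ u ∈ H.maxSet f e, rS e u ≠ 0 → ∀ v ∈ H.maxSet f e, r v ≤ r u
  /-- Rule 2a, negative discrepancy: all the vertices of `S_f(e)` change at the same rate -/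
  neg_S : ∀ e, H.disc f e < 0 → ∀ u ∈ H.maxSet f e, rS e u ≠ 0 → ∀ v ∈ H.maxSet f e, r u = r v
  /-- Rule 2b, negative discrepancy: the vertices of `I_f(e)` can only gain, and only those with
  the smallest rate of change take part -/
  neg_I_sign : ∀ e, H.disc f e < 0 → ∀ v, 0 ≤ rI e v
  neg_I : ∀ e, H.disc f e < 0 → ∀ u ∈ H.minSet f e, rI e u ≠ 0 → ∀ v ∈ H.minSet f e, r u ≤ r v
  /-- Rule 2b, positive discrepancy: all the vertices of `I_f(e)` change at the same rate -/
  pos_I : ∀ e, 0 < H.disc f e → ∀ u ∈ H.minSet f e, rI e u ≠ 0 → ∀ v ∈ H.minSet f e, r u = r v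

/-- `r` is a rate of change of the diffusion at `f`. -/
def IsRate (f r : V → ℝ) : Prop := ∃ rS rI : H.edges → V → ℝ, H.IsDiffusion f r rS rI

end Basic

/-! The rules determine the rate of change: existence and uniqueness. -/

section WellDefined

set_option linter.unusedSectionVars false

open scoped Pointwise

variable {V : Type*} [Fintype V] [DecidableEq V]

theorem exists_rates_aux {J : Type*} [Fintype J] [DecidableEq J] (X : J → Finset V)
    (hX : ∀ j, (X j).Nonempty) (m : J → ℝ) (free : J → Prop) (d : V → ℝ)
    (hd : ∀ j, ∀ v ∈ X j, 0 < d v) :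
    ∃ (a : J → V → ℝ) (r : V → ℝ), (∀ v, r v = ∑ j, a j v) ∧ (∀ j, ∀ v ∉ X j, a j v = 0) ∧
      (∀ j, ∑ v ∈ X j, d v * a j v = m j) ∧ (∀ j, ¬ free j → ∀ v, 0 ≤ m j * a j v) ∧
      (∀ j, ¬ free j → m j = 0 → ∀ v, a j v = 0) ∧
      (∀ j, ¬ free j → ∀ u ∈ X j, a j u ≠ 0 → ∀ v ∈ X j, m j * r u ≤ m j * r v) ∧
      (∀ j, free j → ∀ u ∈ X j, ∀ v ∈ X j, r u = r v) := by
  classical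
  let T : (J → V → ℝ) →ₗ[ℝ] EuclideanSpace ℝ V :=
    { toFun := fun x => WithLp.toLp 2 fun v => (∑ j, x j v) / √(d v)
      map_add' := by
        intro x y; ext v; simp [Finset.sum_add_distrib, add_div]
      map_smul' := by
        intro c x; ext v; simp [← Finset.mul_sum, mul_div_assoc] }
  let M : (J → V → ℝ) →ₗ[ℝ] (J → V → ℝ) :=
    { toFun := fun p j v => m j * p j v
      map_add' := by intro x y; ext j v; simp [mul_add]
      map_smul' := by intro c x; ext j v; simp; ring }
  let C : Set (J → V → ℝ) :=
    {p | ∀ j, (∀ v, 0 ≤ p j v) ∧ (∀ v ∉ X j, p j v = 0) ∧ ∑ v, p j v = 1}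
  let L : Submodule ℝ (J → V → ℝ) :=
    { carrier := {l | ∀ j, (¬ free j → ∀ v, l j v = 0) ∧ (∀ v ∉ X j, l j v = 0) ∧
        ∑ v, l j v = 0}
      add_mem' := by
        intro a b ha hb j
        refine ⟨fun h v => ?_, fun v hv => ?_, ?_⟩
        · simp [(ha j).1 h v, (hb j).1 h v]
        · simp [(ha j).2.1 v hv, (hb j).2.1 v hv]
        · simp [Finset.sum_add_distrib, (ha j).2.2, (hb j).2.2]
      zero_mem' := by intro j; simp
      smul_mem' := by
        intro c a ha j
        refine ⟨fun h v => ?_, fun v hv => ?_, ?_⟩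
        · simp [(ha j).1 h v]
        · simp [(ha j).2.1 v hv]
        · simp [← Finset.mul_sum, (ha j).2.2] }
  have hCcomp : IsCompact C := by
    have hcl : IsClosed C := by
      have : C = ⋂ j, ((⋂ v, {p : J → V → ℝ | 0 ≤ p j v}) ∩
          ((⋂ v, ⋂ (_ : v ∉ X j), {p : J → V → ℝ | p j v = 0}) ∩
            {p : J → V → ℝ | ∑ v, p j v = 1})) := by
        ext p; simp [C]
      rw [this]
      refine isClosed_iInter fun j => (isClosed_iInter fun v => ?_).inter
        ((isClosed_iInter fun v => isClosed_iInter fun _ => ?_).inter ?_)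
      · exact isClosed_le continuous_const (by fun_prop)
      · exact isClosed_eq (by fun_prop) continuous_const
      · exact isClosed_eq (by fun_prop) continuous_const
    refine (isCompact_Icc (a := (0 : J → V → ℝ)) (b := 1)).of_isClosed_subset hcl ?_
    intro p hp
    refine ⟨fun j v => (hp j).1 v, fun j v => ?_⟩
    have := Finset.single_le_sum (f := p j) (fun v _ => (hp j).1 v) (Finset.mem_univ v)
    rw [(hp j).2.2] at this
    exact this
  have hCconv : Convex ℝ C := by
    intro p hp q hq s t hs ht hst j
    refine ⟨fun v => ?_, fun v hv => ?_, ?_⟩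
    · have h1 := (hp j).1 v
      have h2 := (hq j).1 v
      simp only [Pi.add_apply, Pi.smul_apply, smul_eq_mul]
      positivity
    · simp [(hp j).2.1 v hv, (hq j).2.1 v hv]
    · simp [Finset.sum_add_distrib, ← Finset.mul_sum, (hp j).2.2, (hq j).2.2, hst]
  have hCne : C.Nonempty := by
    refine ⟨fun j => Pi.single (hX j).choose 1, fun j => ⟨fun v => ?_, fun v hv => ?_, ?_⟩⟩
    · by_cases h : v = (hX j).choose
      · subst h; simp
      · simp [Pi.single_eq_of_ne h]
    · have h : v ≠ (hX j).choose := fun h => hv (h ▸ (hX j).choose_spec)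
      simp [Pi.single_eq_of_ne h]
    · simp
  let A : Set (EuclideanSpace ℝ V) := (T ∘ₗ M) '' C
  let K : Set (EuclideanSpace ℝ V) := A + (L.map T : Set (EuclideanSpace ℝ V))
  have hAcomp : IsCompact A := hCcomp.image (LinearMap.continuous_of_finiteDimensional _)
  have hKclosed : IsClosed K :=
    (Submodule.closed_of_finiteDimensional (L.map T)).add_left_of_isCompact hAcomp
  have hKconv : Convex ℝ K := (hCconv.linear_image _).add (L.map T).convex
  have hKne : K.Nonempty := (hCne.image _).add ⟨0, (L.map T).zero_mem⟩
  obtain ⟨y, hyK, hy⟩ := exists_norm_eq_iInf_of_complete_convex hKne hKclosed.isComplete hKconv 0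
  rw [norm_eq_iInf_iff_real_inner_le_zero hKconv hyK] at hy
  obtain ⟨_, ⟨p, hp, rfl⟩, _, ⟨l, hl, rfl⟩, rfl⟩ := hyK
  let x : J → V → ℝ := M p + l
  have hxT : (T ∘ₗ M) p + T l = T x := by simp [x]
  rw [show (fun x1 x2 => x1 + x2) ((T ∘ₗ M) p) (T l) = T x from hxT] at hy
  let r : V → ℝ := fun v => ∑ j, x j v / d v
  have hx0 : ∀ j, ∀ v ∉ X j, x j v = 0 := fun j v hv => by
    simp [x, M, (hp j).2.1 v hv, (hl j).2.1 v hv]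
  have hinner : ∀ z : J → V → ℝ, (∀ j, ∀ v ∉ X j, z j v = 0) →
      inner ℝ (T x) (T z) = ∑ v, r v * ∑ j, z j v := by
    intro z hz
    rw [PiLp.inner_apply]
    refine Finset.sum_congr rfl fun v _ => ?_
    by_cases hv : ∃ j, v ∈ X j
    · obtain ⟨j, hj⟩ := hv
      have hdv := hd j v hj
      have hs : √(d v) * √(d v) = d v := Real.mul_self_sqrt hdv.le
      have hs0 : √(d v) ≠ 0 := (Real.sqrt_pos.2 hdv).ne'
      simp only [T, LinearMap.coe_mk, AddHom.coe_mk, r, ← Finset.sum_div]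
      simp only [RCLike.inner_apply, conj_trivial]
      rw [div_mul_div_comm, hs]
      ring
    · push Not at hv
      simp [T, Finset.sum_eq_zero fun j _ => hz j v (hv j)]
  have hvar : ∀ z : J → V → ℝ, (∀ j, ∀ v ∉ X j, z j v = 0) → T (x + z) ∈ K →
      0 ≤ ∑ v, r v * ∑ j, z j v := by
    intro z hz hmem
    have := hy _ hmem
    rw [T.map_add x z, add_sub_cancel_left, zero_sub, inner_neg_left, hinner z hz] at this
    linarith
  -- the elementary variation that moves mass `c` from `u` to `v` in the `j`-th set
  let mv : J → V → V → ℝ → J → V → ℝ := fun j u v c =>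
    Pi.single j (Pi.single v c - Pi.single u c)
  have mv_self : ∀ j u v c w, mv j u v c j w = (Pi.single v c - Pi.single u c : V → ℝ) w := by
    intro j u v c w; simp [mv]
  have mv_ne : ∀ j u v c j' w, j' ≠ j → mv j u v c j' w = 0 := by
    intro j u v c j' w h; simp [mv, Pi.single_eq_of_ne h]
  have mv_supp : ∀ j, ∀ u ∈ X j, ∀ v ∈ X j, ∀ c, ∀ j', ∀ w ∉ X j', mv j u v c j' w = 0 := by
    intro j u hu v hv c j' w hw
    by_cases h : j' = j
    · subst h
      have h1 : w ≠ u := fun h => hw (h ▸ hu)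
      have h2 : w ≠ v := fun h => hw (h ▸ hv)
      rw [mv_self]; simp [Pi.single_eq_of_ne h1, Pi.single_eq_of_ne h2]
    · exact mv_ne _ _ _ _ _ _ h
  have mv_sum : ∀ j u v c j', ∑ w, mv j u v c j' w = 0 := by
    intro j u v c j'
    by_cases h : j' = j
    · subst h; simp [mv_self, Finset.sum_sub_distrib]
    · simp [mv_ne _ _ _ _ _ _ h]
  have mv_val : ∀ j u v c, ∑ w, r w * ∑ j', mv j u v c j' w = c * (r v - r u) := by
    intro j u v c
    have : ∀ w, ∑ j', mv j u v c j' w = (Pi.single v c - Pi.single u c : V → ℝ) w := by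
      intro w
      rw [Finset.sum_eq_single j (fun j' _ h => mv_ne _ _ _ _ _ _ h) (by simp), mv_self]
    simp only [this, Pi.sub_apply, mul_sub, Finset.sum_sub_distrib]
    simp [Pi.single_apply]
    ring
  have hsumX : ∀ j, ∀ z : V → ℝ, (∀ v ∉ X j, z v = 0) → ∑ v ∈ X j, z v = ∑ v, z v :=
    fun j z hz => Finset.sum_subset (Finset.subset_univ _) fun v _ hv => hz v hv
  have hxfree : ∀ j, ¬ free j → ∀ v, x j v = m j * p j v := by
    intro j hj v; simp [x, M, (hl j).1 hj v]
  refine ⟨fun j v => x j v / d v, r, fun v => rfl, fun j v hv => by simp [hx0 j v hv],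
    fun j => ?_, fun j hj v => ?_, fun j hj hm v => ?_, fun j hj u hu hau v hv => ?_,
    fun j hj u hu v hv => ?_⟩
  · rw [Finset.sum_congr rfl (g := x j)
      (fun v hv => mul_div_cancel₀ (x j v) (hd j v hv).ne'), hsumX j _ (hx0 j)]
    simp [x, M, Finset.sum_add_distrib, ← Finset.mul_sum, (hp j).2.2, (hl j).2.2]
  · show 0 ≤ m j * (x j v / d v)
    by_cases hv : v ∈ X j
    · rw [hxfree j hj]
      have := hd j v hv
      have := (hp j).1 v
      rw [show m j * (m j * p j v / d v) = m j ^ 2 * p j v / d v by ring]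
      positivity
    · simp [hx0 j v hv]
  · show x j v / d v = 0
    simp [hxfree j hj, hm]
  · have hpu : p j u ≠ 0 := by
      intro h; apply hau
      show x j u / d u = 0
      simp [hxfree j hj, h]
    have hpu' : 0 < p j u := lt_of_le_of_ne ((hp j).1 u) hpu.symm
    have hmem : p + mv j u v (p j u) ∈ C := by
      intro j'
      refine ⟨fun w => ?_, fun w hw => ?_, ?_⟩
      · by_cases h : j' = j
        · subst h
          have h0 := (hp j').1 w
          rw [Pi.add_apply, Pi.add_apply, mv_self, Pi.sub_apply, Pi.single_apply, Pi.single_apply]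
          split_ifs <;> subst_vars <;> linarith
        · rw [Pi.add_apply, Pi.add_apply, mv_ne _ _ _ _ _ _ h, add_zero]
          exact (hp j').1 w
      · rw [Pi.add_apply, Pi.add_apply, mv_supp j u hu v hv _ j' w hw, (hp j').2.1 w hw, add_zero]
      · simp only [Pi.add_apply, Finset.sum_add_distrib, mv_sum, (hp j').2.2, add_zero]
    have hM : M (mv j u v (p j u)) = mv j u v (m j * p j u) := by
      ext j' w
      by_cases h : j' = j
      · subst h
        simp [M, mv_self, Pi.single_apply, mul_sub]
      · simp [M, mv_ne _ _ _ _ _ _ h]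
    have hv' := hvar (mv j u v (m j * p j u)) (mv_supp j u hu v hv _) (by
      refine ⟨_, ⟨_, hmem, rfl⟩, T l, ⟨l, hl, rfl⟩, ?_⟩
      rw [← hM]
      simp only [x, map_add, LinearMap.comp_apply]
      abel)
    rw [mv_val] at hv'
    have : 0 ≤ p j u * (m j * r v - m j * r u) := by linarith
    have := nonneg_of_mul_nonneg_right this hpu'
    linarith
  · have key : ∀ c, 0 ≤ c * (r v - r u) := by
      intro c
      rw [← mv_val j u v c]
      refine hvar _ (mv_supp j u hu v hv _) ⟨_, ⟨p, hp, rfl⟩, T (l + mv j u v c), ⟨_, ?_, rfl⟩, ?_⟩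
      · refine L.add_mem hl fun j' => ⟨fun h w => ?_, fun w hw => mv_supp j u hu v hv _ j' w hw,
          mv_sum _ _ _ _ _⟩
        exact mv_ne _ _ _ _ _ _ (fun h' => h (h' ▸ hj))
      · simp only [x, map_add, LinearMap.comp_apply]
        abel
    have h1 := key 1
    have h2 := key (-1)
    linarith

variable (H : WeightedHypergraph V)

theorem deg_pos_of_mem {e : H.edges} {v : V} (hv : v ∈ (e : Finset V)) : 0 < H.deg v := by
  unfold deg
  refine Finset.sum_pos' (fun e _ => ?_) ⟨e, Finset.mem_univ _, ?_⟩
  · split_ifs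
    · exact (H.weight_pos e).le
    · exact le_rfl
  · simp [hv, H.weight_pos e]

theorem maxSet_nonempty (f : V → ℝ) (e : H.edges) : (H.maxSet f e).Nonempty := by
  obtain ⟨v, hv, h⟩ := Finset.exists_mem_eq_sup' (H.edge_nonempty e) f
  exact ⟨v, Finset.mem_filter.2 ⟨hv, h.symm⟩⟩

theorem minSet_nonempty (f : V → ℝ) (e : H.edges) : (H.minSet f e).Nonempty := by
  obtain ⟨v, hv, h⟩ := Finset.exists_mem_eq_inf' (H.edge_nonempty e) f
  exact ⟨v, Finset.mem_filter.2 ⟨hv, h.symm⟩⟩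

theorem exists_isRate (f : V → ℝ) : ∃ r, H.IsRate f r := by
  classical
  obtain ⟨a, r, hr, hs, ht, hsg, hz, hmx, hfr⟩ := exists_rates_aux (J := H.edges ⊕ H.edges)
    (Sum.elim (H.maxSet f) (H.minSet f))
    (by rintro (e | e); exacts [H.maxSet_nonempty f e, H.minSet_nonempty f e])
    (fun j => -(H.weight (j.elim id id) * H.disc f (j.elim id id)))
    (Sum.elim (fun e => H.disc f e < 0) (fun e => 0 < H.disc f e)) H.deg
    (by
      rintro (e | e) v hv
      · exact H.deg_pos_of_mem (Finset.mem_filter.1 hv).1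
      · exact H.deg_pos_of_mem (Finset.mem_filter.1 hv).1)
  have hw := H.weight_pos
  refine ⟨r, fun e => a (.inl e), fun e => a (.inr e), ?_⟩
  constructor
  · exact fun e => hs (.inl e)
  · exact fun e => hs (.inr e)
  · intro v; rw [hr, Fintype.sum_sum_type, Finset.sum_add_distrib]
  · exact fun e => ht (.inl e)
  · exact fun e => ht (.inr e)
  · exact fun e h v => hz (.inl e) (by simp [h]) (by simp [h]) v
  · exact fun e h v => hz (.inr e) (by simp [h]) (by simp [h]) v
  · intro e h v
    have := hsg (.inl e) (by simp [h.le]) v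
    have h2 := mul_pos (hw e) h
    simp only [Sum.elim_inl, id] at this
    by_contra! hc
    nlinarith [mul_pos h2 hc]
  · intro e h u hu hau v hv
    have := hmx (.inl e) (by simp [h.le]) u hu hau v hv
    have h2 := mul_pos (hw e) h
    simp only [Sum.elim_inl, id] at this
    nlinarith
  · exact fun e h u hu _ v hv => hfr (.inl e) h u hu v hv
  · intro e h v
    have := hsg (.inr e) (by simp [h.le]) v
    have h2 := mul_neg_of_pos_of_neg (hw e) h
    simp only [Sum.elim_inr, id] at this
    by_contra! hc
    nlinarith [mul_pos_of_neg_of_neg h2 hc]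
  · intro e h u hu hau v hv
    have := hmx (.inr e) (by simp [h.le]) u hu hau v hv
    have h2 := mul_neg_of_pos_of_neg (hw e) h
    simp only [Sum.elim_inr, id] at this
    nlinarith
  · exact fun e h u hu _ v hv => hfr (.inr e) h u hu v hv

/-- Monotonicity of the contribution of one edge in the constrained case. -/
theorem mono_aux (X : Finset V) (d a a' r r' : V → ℝ) (m : ℝ)
    (hd : ∀ v ∈ X, 0 ≤ d v) (ha : ∑ v ∈ X, d v * a v = m) (ha' : ∑ v ∈ X, d v * a' v = m)
    (hs : ∀ v, a v ≤ 0) (hs' : ∀ v, a' v ≤ 0)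
    (hm : ∀ u ∈ X, a u ≠ 0 → ∀ v ∈ X, r v ≤ r u)
    (hm' : ∀ u ∈ X, a' u ≠ 0 → ∀ v ∈ X, r' v ≤ r' u) :
    ∑ v ∈ X, d v * (a v - a' v) * (r v - r' v) ≤ 0 := by
  rcases X.eq_empty_or_nonempty with rfl | hX
  · simp
  obtain ⟨s, hsX, hsm⟩ := X.exists_max_image r hX
  obtain ⟨s', hsX', hsm'⟩ := X.exists_max_image r' hX
  have key : ∀ v ∈ X, d v * (a v - a' v) * (r v - r' v) ≤
      (d v * a v) * (r s - r' s') - (d v * a' v) * (r s - r' s') := by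
    intro v hv
    have h0 := hd v hv
    have e1 : a v * r v = a v * r s := by
      by_cases h : a v = 0
      · simp [h]
      · rw [le_antisymm (hsm v hv) (hm v hv h s hsX)]
    have e2 : a' v * r' v = a' v * r' s' := by
      by_cases h : a' v = 0
      · simp [h]
      · rw [le_antisymm (hsm' v hv) (hm' v hv h s' hsX')]
    have i1 : a v * r' s' ≤ a v * r' v := mul_le_mul_of_nonpos_left (hsm' v hv) (hs v)
    have i2 : a' v * r s ≤ a' v * r v := mul_le_mul_of_nonpos_left (hsm v hv) (hs' v)
    have : (a v - a' v) * (r v - r' v) ≤ a v * (r s - r' s') - a' v * (r s - r' s') := by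
      linarith
    have := mul_le_mul_of_nonneg_left this h0
    linarith
  refine (Finset.sum_le_sum key).trans ?_
  rw [Finset.sum_sub_distrib, ← Finset.sum_mul, ← Finset.sum_mul, ha, ha', sub_self]

/-- The contribution of one edge in the case where the rates are constant on the set. -/
theorem const_aux (X : Finset V) (d a a' r r' : V → ℝ) (m : ℝ) (hm0 : m ≠ 0)
    (ha : ∑ v ∈ X, d v * a v = m) (ha' : ∑ v ∈ X, d v * a' v = m)
    (hm : ∀ u ∈ X, a u ≠ 0 → ∀ v ∈ X, r u = r v)
    (hm' : ∀ u ∈ X, a' u ≠ 0 → ∀ v ∈ X, r' u = r' v) :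
    ∑ v ∈ X, d v * (a v - a' v) * (r v - r' v) ≤ 0 := by
  have ex : ∀ b : V → ℝ, ∑ v ∈ X, d v * b v = m → ∃ u ∈ X, b u ≠ 0 := by
    intro b hb
    by_contra! h
    exact hm0 (hb ▸ Finset.sum_eq_zero fun v hv => by rw [h v hv, mul_zero])
  obtain ⟨u, hu, hau⟩ := ex a ha
  obtain ⟨u', hu', hau'⟩ := ex a' ha'
  have key : ∀ v ∈ X, d v * (a v - a' v) * (r v - r' v) =
      (d v * a v) * (r u - r' u') - (d v * a' v) * (r u - r' u') := by
    intro v hv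
    rw [← hm u hu hau v hv, ← hm' u' hu' hau' v hv]; ring
  rw [Finset.sum_congr rfl key, Finset.sum_sub_distrib, ← Finset.sum_mul, ← Finset.sum_mul, ha, ha',
    sub_self]

theorem isRate_unique (f r r' : V → ℝ) (h : H.IsRate f r) (h' : H.IsRate f r') : r = r' := by
  obtain ⟨a, b, h⟩ := h
  obtain ⟨a', b', h'⟩ := h'
  have hS : ∀ e, ∑ v ∈ H.maxSet f e, H.deg v * (a e v - a' e v) * (r v - r' v) ≤ 0 := by
    intro e
    have hd : ∀ v ∈ H.maxSet f e, 0 ≤ H.deg v := fun v hv =>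
      (H.deg_pos_of_mem (Finset.mem_filter.1 hv).1).le
    rcases lt_trichotomy (H.disc f e) 0 with hc | hc | hc
    · exact const_aux _ _ _ _ _ _ _ (neg_ne_zero.2 (mul_ne_zero (H.weight_pos e).ne' hc.ne))
        (h.total_S e) (h'.total_S e) (h.neg_S e hc) (h'.neg_S e hc)
    · simp [h.zero_S e hc, h'.zero_S e hc]
    · exact mono_aux _ _ _ _ _ _ _ hd (h.total_S e) (h'.total_S e) (h.pos_S_sign e hc)
        (h'.pos_S_sign e hc) (h.pos_S e hc) (h'.pos_S e hc)
  have hI : ∀ e, ∑ v ∈ H.minSet f e, H.deg v * (b e v - b' e v) * (r v - r' v) ≤ 0 := by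
    intro e
    have hd : ∀ v ∈ H.minSet f e, 0 ≤ H.deg v := fun v hv =>
      (H.deg_pos_of_mem (Finset.mem_filter.1 hv).1).le
    rcases lt_trichotomy (H.disc f e) 0 with hc | hc | hc
    · have := mono_aux (H.minSet f e) H.deg (-b e) (-b' e) (-r) (-r') (H.weight e * H.disc f e) hd
        (by simpa using congrArg Neg.neg (h.total_I e))
        (by simpa using congrArg Neg.neg (h'.total_I e))
        (fun v => by simpa using h.neg_I_sign e hc v)
        (fun v => by simpa using h'.neg_I_sign e hc v)
        (fun u hu hb v hv => by simpa using h.neg_I e hc u hu (by simpa using hb) v hv)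
        (fun u hu hb v hv => by simpa using h'.neg_I e hc u hu (by simpa using hb) v hv)
      refine le_of_eq_of_le (Finset.sum_congr rfl fun v _ => ?_) this
      simp only [Pi.neg_apply]; ring
    · simp [h.zero_I e hc, h'.zero_I e hc]
    · exact const_aux _ _ _ _ _ _ _ (neg_ne_zero.2 (mul_ne_zero (H.weight_pos e).ne' hc.ne'))
        (h.total_I e) (h'.total_I e) (h.pos_I e hc) (h'.pos_I e hc)
  have hS' : ∀ e, ∑ v, H.deg v * (a e v - a' e v) * (r v - r' v) ≤ 0 := fun e =>
    (Finset.sum_subset (Finset.subset_univ _) fun v _ hv => by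
      rw [h.supp_S e v hv, h'.supp_S e v hv]; ring).symm.trans_le (hS e)
  have hI' : ∀ e, ∑ v, H.deg v * (b e v - b' e v) * (r v - r' v) ≤ 0 := fun e =>
    (Finset.sum_subset (Finset.subset_univ _) fun v _ hv => by
      rw [h.supp_I e v hv, h'.supp_I e v hv]; ring).symm.trans_le (hI e)
  have hdeg : ∀ v, 0 ≤ H.deg v := fun v =>
    Finset.sum_nonneg fun e _ => by split_ifs; exacts [(H.weight_pos e).le, le_rfl]
  have htot : ∑ v, H.deg v * (r v - r' v) ^ 2 ≤ 0 := by
    have : ∑ v, H.deg v * (r v - r' v) ^ 2 =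
        ∑ e : H.edges, (∑ v, H.deg v * (a e v - a' e v) * (r v - r' v) +
          ∑ v, H.deg v * (b e v - b' e v) * (r v - r' v)) := by
      simp_rw [← Finset.sum_add_distrib]
      rw [Finset.sum_comm]
      refine Finset.sum_congr rfl fun v _ => ?_
      rw [sq, ← mul_assoc]
      nth_rw 1 [h.rate v, h'.rate v]
      rw [← Finset.sum_sub_distrib, Finset.mul_sum, Finset.sum_mul]
      refine Finset.sum_congr rfl fun e _ => ?_
      ring
    rw [this]
    exact Finset.sum_nonpos fun e _ => add_nonpos (hS' e) (hI' e)
  have hz := (Finset.sum_eq_zero_iff_of_nonneg fun v _ => mul_nonneg (hdeg v) (sq_nonneg _)).1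
    (le_antisymm htot (Finset.sum_nonneg fun v _ => mul_nonneg (hdeg v) (sq_nonneg _)))
  funext v
  by_cases hv : ∃ e : H.edges, v ∈ (e : Finset V)
  · obtain ⟨e, he⟩ := hv
    have := hz v (Finset.mem_univ v)
    have hd := H.deg_pos_of_mem he
    have := (mul_eq_zero.1 this).resolve_left hd.ne'
    exact sub_eq_zero.1 (pow_eq_zero_iff (two_ne_zero) |>.1 this)
  · push Not at hv
    have e1 : ∀ e, v ∉ H.maxSet f e := fun e hh => hv e (Finset.mem_filter.1 hh).1
    have e2 : ∀ e, v ∉ H.minSet f e := fun e hh => hv e (Finset.mem_filter.1 hh).1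
    rw [h.rate v, h'.rate v]
    refine Finset.sum_congr rfl fun e _ => ?_
    rw [h.supp_S e v (e1 e), h'.supp_S e v (e1 e), h.supp_I e v (e2 e), h'.supp_I e v (e2 e)]

/-- There is exactly one rate of change that satisfies the rules of the diffusion. -/
theorem existsUnique_isRate (f : V → ℝ) : ∃! r, H.IsRate f r := by
  obtain ⟨r, hr⟩ := H.exists_isRate f
  exact ⟨r, hr, fun r' hr' => H.isRate_unique f r' r hr' hr⟩

end WellDefined

section Operator

variable {V : Type*} [Fintype V] [DecidableEq V] (H : WeightedHypergraph V)

/-- The rate of change `r = df/dt` of the diffusion at `f`. -/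
noncomputable def rate (f : V → ℝ) : V → ℝ := (H.existsUnique_isRate f).choose

theorem rate_spec (f : V → ℝ) : H.IsRate f (H.rate f) := (H.existsUnique_isRate f).choose_spec.1

/-- The (nonlinear) operator `J_H`, determined by `df/dt = -D_H⁻¹ J_H f`, that is
`J_H f = -D_H r`. -/
noncomputable def J (f : V → ℝ) : V → ℝ := -(H.degMatrix *ᵥ H.rate f)

/-- `(lam, f)` is an eigen-pair of `J_H` with respect to the degrees: `J_H f = lam • D_H f` with
`‖f‖_w ≠ 0`. If all degrees are positive this says `D_H⁻¹ J_H f = lam • f` with `f ≠ 0`, see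
`isEigenpair_iff`. -/
def IsEigenpair (lam : ℝ) (f : V → ℝ) : Prop :=
  H.wNormSq f ≠ 0 ∧ H.J f = lam • (H.degMatrix *ᵥ f)

/-- `lam` is an eigenvalue of `J_H` with respect to the degrees. -/
def IsEigenvalue (lam : ℝ) : Prop := ∃ f, H.IsEigenpair lam f

theorem isEigenpair_iff (hdeg : ∀ v, 0 < H.deg v) (lam : ℝ) (f : V → ℝ) :
    H.IsEigenpair lam f ↔ f ≠ 0 ∧ H.degMatrix⁻¹ *ᵥ H.J f = lam • f := by
  have hu : IsUnit H.degMatrix.det := by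
    rw [degMatrix, Matrix.det_diagonal]
    exact (Finset.prod_ne_zero_iff.2 fun v _ => (hdeg v).ne').isUnit
  have hn : H.wNormSq f ≠ 0 ↔ f ≠ 0 := by
    refine not_congr ⟨fun h => ?_, fun h => by simp [wNormSq, h]⟩
    have h' : ∑ v, H.deg v * f v ^ 2 = 0 := by
      rw [← h, wNormSq, degMatrix]
      simp only [dotProduct, Matrix.mulVec_diagonal]
      exact Finset.sum_congr rfl fun v _ => by ring
    funext v
    have := (Finset.sum_eq_zero_iff_of_nonneg
      fun v _ => mul_nonneg (hdeg v).le (sq_nonneg (f v))).1 h' v (Finset.mem_univ v)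
    simpa [(hdeg v).ne'] using this
  refine and_congr hn ⟨fun h => ?_, fun h => ?_⟩
  · rw [h, Matrix.mulVec_smul, Matrix.mulVec_mulVec, Matrix.nonsing_inv_mul _ hu,
      Matrix.one_mulVec]
  · rw [← Matrix.mulVec_smul, ← h, Matrix.mulVec_mulVec, Matrix.mul_nonsing_inv _ hu,
      Matrix.one_mulVec]

end Operator

end WeightedHypergraph

namespace WeightedHypergraph

set_option linter.unusedSectionVars false

open Filter Topology

variable {V : Type*} [Fintype V] [DecidableEq V] (H : WeightedHypergraph V)

/-! Write `Q(f) = ∑ₑ w(e) Δ_f(e)²` and `⟨f, g⟩ = fᵀ D_H g`. Isolated vertices affect neither `Q` nor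
the norm, and both `Q` and the squared norm scale quadratically. So minimizing the ratio amounts to
minimizing the continuous `Q` on a compact sphere, and the minimum `γ` is attained
(`exists_isLeast_discRatio`).

Let `f` be a minimizer and `r` its rate of change. Then `Q(h) ≥ γ‖h‖²` for all `h`, with equality at
`f`. For small `t > 0`, moving to `f + t r` changes `Δ_f(e)` by exactly `t c(e)`, where `c(e)` is
the maximum of `r` on `S_f(e)` plus its minimum on `I_f(e)`. Comparing first-order terms gives `γ⟨f,
r⟩ ≤ ∑ₑ w(e) Δ_f(e) c(e)` (`first_order_le`).

The rules make mass flow only where `r` takes these extreme values, so the right side is `-‖r‖²`.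
Pairing `r` with `f` instead gives `⟨f, r⟩ = -Q(f) = -γ‖f‖²` (both from
`IsDiffusion.sum_deg_mul_rate`). Hence `‖r + γf‖² ≤ γ⟨f, r⟩ + γ²‖f‖² = 0`, so `-D_H r = γ D_H f`. -/

/-! ### Elementary properties of the norm and the energy -/

theorem deg_nonneg (v : V) : 0 ≤ H.deg v :=
  Finset.sum_nonneg fun e _ => by split_ifs; exacts [(H.weight_pos e).le, le_rfl]

theorem wNormSq_eq_sum (f : V → ℝ) : H.wNormSq f = ∑ v, H.deg v * f v ^ 2 := by
  simp only [wNormSq, degMatrix, dotProduct, Matrix.mulVec_diagonal]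
  exact Finset.sum_congr rfl fun v _ => by ring

theorem wNormSq_nonneg (f : V → ℝ) : 0 ≤ H.wNormSq f := by
  rw [wNormSq_eq_sum]
  exact Finset.sum_nonneg fun v _ => mul_nonneg (H.deg_nonneg v) (sq_nonneg _)

/-- The numerator `∑ₑ w(e) Δ_f(e)²` of the discrepancy ratio. -/
noncomputable def discEnergy (f : V → ℝ) : ℝ := ∑ e : H.edges, H.weight e * H.disc f e ^ 2

theorem discRatio_eq (f : V → ℝ) : H.discRatio f = H.discEnergy f / H.wNormSq f := rfl

theorem discEnergy_nonneg (f : V → ℝ) : 0 ≤ H.discEnergy f :=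
  Finset.sum_nonneg fun e _ => mul_nonneg (H.weight_pos e).le (sq_nonneg _)

/-- Reflection `f ↦ -f` transfers statements about maxima to minima, so each is proved only once. -/
theorem edgeMin_eq_neg_edgeMax (f : V → ℝ) (e : H.edges) :
    H.edgeMin f e = -H.edgeMax (-f) e := by
  refine le_antisymm ?_ (Finset.le_inf' _ _ fun v hv => ?_)
  · rw [le_neg]
    exact Finset.sup'_le _ _ fun v hv => neg_le_neg (Finset.inf'_le f hv)
  · exact neg_le.1 (Finset.le_sup' (-f) hv)

theorem minSet_eq_maxSet_neg (f : V → ℝ) (e : H.edges) : H.minSet f e = H.maxSet (-f) e := by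
  ext v
  simp only [minSet, maxSet, Finset.mem_filter, edgeMin_eq_neg_edgeMax, Pi.neg_apply,
    neg_eq_iff_eq_neg]

theorem edgeMax_smul {c : ℝ} (hc : 0 ≤ c) (f : V → ℝ) (e : H.edges) :
    H.edgeMax (c • f) e = c * H.edgeMax f e := by
  obtain ⟨s, hs⟩ := H.maxSet_nonempty f e
  obtain ⟨hse, hs⟩ := Finset.mem_filter.1 hs
  refine le_antisymm (Finset.sup'_le _ _ fun v hv => ?_) ?_
  · exact mul_le_mul_of_nonneg_left (Finset.le_sup' f hv) hc
  · rw [← hs]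
    exact Finset.le_sup' (c • f) hse

theorem disc_smul {c : ℝ} (hc : 0 ≤ c) (f : V → ℝ) (e : H.edges) :
    H.disc (c • f) e = c * H.disc f e := by
  rw [disc, disc, edgeMin_eq_neg_edgeMax, edgeMin_eq_neg_edgeMax, ← smul_neg,
    H.edgeMax_smul hc, H.edgeMax_smul hc]
  ring

theorem discEnergy_smul {c : ℝ} (hc : 0 ≤ c) (f : V → ℝ) :
    H.discEnergy (c • f) = c ^ 2 * H.discEnergy f := by
  simp only [discEnergy, H.disc_smul hc, Finset.mul_sum]
  exact Finset.sum_congr rfl fun e _ => by ring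

theorem wNormSq_smul (c : ℝ) (f : V → ℝ) : H.wNormSq (c • f) = c ^ 2 * H.wNormSq f := by
  simp only [wNormSq_eq_sum, Finset.mul_sum, Pi.smul_apply, smul_eq_mul]
  exact Finset.sum_congr rfl fun e _ => by ring

theorem continuous_edgeMax (e : H.edges) : Continuous fun f => H.edgeMax f e :=
  Continuous.finset_sup'_apply (H.edge_nonempty e) fun v _ => continuous_apply v

theorem continuous_discEnergy : Continuous H.discEnergy := by
  refine continuous_finsetSum _ fun e _ => continuous_const.mul (Continuous.pow ?_ 2)
  simp only [disc, edgeMin_eq_neg_edgeMax]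
  exact (H.continuous_edgeMax e).add ((H.continuous_edgeMax e).comp continuous_neg).neg

/-- A vertex of degree zero lies in no edge. This allows a vector to be set to zero there, which
compactness requires. -/
theorem discEnergy_congr {f g : V → ℝ} (h : ∀ v, H.deg v ≠ 0 → f v = g v) :
    H.discEnergy f = H.discEnergy g := by
  have hv : ∀ e : H.edges, ∀ v ∈ (e : Finset V), f v = g v := fun e v hv =>
    h v (H.deg_pos_of_mem hv).ne'
  refine Finset.sum_congr rfl fun e _ => ?_
  rw [disc, disc, edgeMax, edgeMax, edgeMin, edgeMin, Finset.sup'_congr _ rfl (hv e),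
    Finset.inf'_congr _ rfl (hv e)]

theorem wNormSq_congr {f g : V → ℝ} (h : ∀ v, H.deg v ≠ 0 → f v = g v) :
    H.wNormSq f = H.wNormSq g := by
  simp only [wNormSq_eq_sum]
  refine Finset.sum_congr rfl fun v _ => ?_
  by_cases hv : H.deg v = 0
  · simp [hv]
  · rw [h v hv]

/-! ### Existence of the minimum -/

theorem exists_wNormSq_ne_zero (hE : H.edges.Nonempty) : ∃ f, H.wNormSq f ≠ 0 := by
  obtain ⟨e, he⟩ := hE
  obtain ⟨v, hv⟩ := H.edge_nonempty ⟨e, he⟩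
  refine ⟨fun _ => 1, ?_⟩
  rw [wNormSq_eq_sum]
  refine (Finset.sum_pos' (fun u _ => mul_nonneg (H.deg_nonneg u) (sq_nonneg _))
    ⟨v, Finset.mem_univ v, ?_⟩).ne'
  simpa using H.deg_pos_of_mem hv

/-- The vectors of norm one that vanish at the isolated vertices. -/
def unitSphere : Set (V → ℝ) := {f | (∀ v, H.deg v = 0 → f v = 0) ∧ H.wNormSq f = 1}

/-- The norm controls only the coordinates of positive degree; the others are bounded because they
are required to vanish. -/
theorem isCompact_unitSphere : IsCompact H.unitSphere := by
  have hcont : Continuous H.wNormSq := by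
    rw [funext H.wNormSq_eq_sum]
    fun_prop
  have hcl : IsClosed H.unitSphere := by
    have : H.unitSphere = (⋂ v, ⋂ (_ : H.deg v = 0), {f : V → ℝ | f v = 0}) ∩
        {f | H.wNormSq f = 1} := by
      ext f; simp [unitSphere]
    rw [this]
    exact (isClosed_iInter fun v => isClosed_iInter fun _ =>
      isClosed_eq (continuous_apply v) continuous_const).inter (isClosed_eq hcont continuous_const)
  -- From `deg(v) f(v)² ≤ 1` comes `f(v)² ≤ x` with `x = deg(v)⁻¹`, and `x ≤ (1 + x)²` avoids a
  -- square root. At degree zero the inverse is `0` by convention and the bound is harmless.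
  refine (isCompact_Icc (a := fun v => -(1 + (H.deg v)⁻¹))
    (b := fun v => 1 + (H.deg v)⁻¹)).of_isClosed_subset hcl fun f hf => ?_
  have key : ∀ v, |f v| ≤ 1 + (H.deg v)⁻¹ := by
    intro v
    rcases (H.deg_nonneg v).eq_or_lt with hv | hv
    · simp [hf.1 v hv.symm, ← hv]
    · have h1 : H.deg v * f v ^ 2 ≤ 1 := by
        rw [← hf.2, wNormSq_eq_sum]
        exact Finset.single_le_sum (f := fun v => H.deg v * f v ^ 2)
          (fun u _ => mul_nonneg (H.deg_nonneg u) (sq_nonneg _)) (Finset.mem_univ v)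
      have h2 : f v ^ 2 ≤ (H.deg v)⁻¹ := by
        rwa [← one_div, le_div_iff₀ hv, mul_comm]
      have h3 := inv_pos.2 hv
      exact abs_le_of_sq_le_sq (by nlinarith) (by linarith)
  exact ⟨fun v => (abs_le.1 (key v)).1, fun v => (abs_le.1 (key v)).2⟩

/-- Clear the isolated vertices and divide by the norm: every value of the ratio is a value of the
energy on the sphere. -/
theorem exists_unitSphere_eq {f : V → ℝ} (hf : H.wNormSq f ≠ 0) :
    ∃ g ∈ H.unitSphere, H.discEnergy g = H.discRatio f := by
  have hpos : 0 < H.wNormSq f := (H.wNormSq_nonneg f).lt_of_ne' hf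
  let f₀ : V → ℝ := fun v => if H.deg v = 0 then 0 else f v
  have h₀ : ∀ v, H.deg v ≠ 0 → f₀ v = f v := fun v hv => if_neg hv
  let c := (√(H.wNormSq f))⁻¹
  have hc : 0 ≤ c := by positivity
  have hc2 : c ^ 2 = (H.wNormSq f)⁻¹ := by rw [inv_pow, Real.sq_sqrt hpos.le]
  refine ⟨c • f₀, ⟨fun v hv => by simp [f₀, hv], ?_⟩, ?_⟩
  · rw [wNormSq_smul, H.wNormSq_congr h₀, hc2, inv_mul_cancel₀ hf]
  · rw [H.discEnergy_smul hc, H.discEnergy_congr h₀, hc2, discRatio_eq, inv_mul_eq_div]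

theorem exists_isLeast_discRatio (hE : H.edges.Nonempty) :
    ∃ γ, IsLeast (H.discRatio '' {f : V → ℝ | H.wNormSq f ≠ 0}) γ := by
  obtain ⟨f₁, hf₁⟩ := H.exists_wNormSq_ne_zero hE
  obtain ⟨g₁, hg₁, -⟩ := H.exists_unitSphere_eq hf₁
  obtain ⟨g, hg, hmin⟩ := H.isCompact_unitSphere.exists_isMinOn ⟨g₁, hg₁⟩
    H.continuous_discEnergy.continuousOn
  refine ⟨H.discEnergy g, ⟨g, ?_, ?_⟩, ?_⟩
  · simp [hg.2]
  · rw [discRatio_eq, hg.2, div_one]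
  · rintro _ ⟨f, hf, rfl⟩
    obtain ⟨h, hh, hhf⟩ := H.exists_unitSphere_eq hf
    exact hhf ▸ hmin hh

/-! ### One-sided derivatives and the first-order condition -/

/-- The one-sided directional derivative of `edgeMax`. -/
theorem eventually_edgeMax_add_smul (f g : V → ℝ) (e : H.edges) {s : V} (hs : s ∈ H.maxSet f e)
    (hmax : ∀ v ∈ H.maxSet f e, g v ≤ g s) :
    ∀ᶠ t : ℝ in 𝓝[>] 0, H.edgeMax (f + t • g) e = H.edgeMax f e + t * g s := by
  obtain ⟨hse, hfs⟩ := Finset.mem_filter.1 hs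
  have hev : ∀ v ∈ (e : Finset V), ∀ᶠ t : ℝ in 𝓝[>] 0, f v + t * g v ≤ f s + t * g s := by
    intro v hv
    -- Ties at `t = 0` are decided by `g`, for which `t ≥ 0` is needed; a strict gap at `t = 0`
    -- persists by continuity.
    by_cases hvm : v ∈ H.maxSet f e
    · filter_upwards [self_mem_nhdsWithin] with t ht
      rw [(Finset.mem_filter.1 hvm).2, hfs]
      exact add_le_add_right (mul_le_mul_of_nonneg_left (hmax v hvm) (le_of_lt ht)) _
    · have hlt : f v < f s := by
        rw [hfs]
        exact (Finset.le_sup' f hv).lt_of_ne fun h => hvm (Finset.mem_filter.2 ⟨hv, h⟩)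
      refine nhdsWithin_le_nhds ?_
      have h1 : ContinuousAt (fun t : ℝ => f v + t * g v) 0 := by fun_prop
      have h2 : ContinuousAt (fun t : ℝ => f s + t * g s) 0 := by fun_prop
      exact (h1.eventually_lt h2 (by simpa using hlt)).mono fun t ht => ht.le
  filter_upwards [(Finset.eventually_all _).2 hev] with t ht
  rw [← hfs]
  exact le_antisymm (Finset.sup'_le _ _ ht) (Finset.le_sup' (f + t • g) hse)

theorem eventually_edgeMin_add_smul (f g : V → ℝ) (e : H.edges) {s : V} (hs : s ∈ H.minSet f e)
    (hmin : ∀ v ∈ H.minSet f e, g s ≤ g v) :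
    ∀ᶠ t : ℝ in 𝓝[>] 0, H.edgeMin (f + t • g) e = H.edgeMin f e + t * g s := by
  rw [minSet_eq_maxSet_neg] at hs hmin
  filter_upwards [H.eventually_edgeMax_add_smul (-f) (-g) e hs
    fun v hv => neg_le_neg (hmin v hv)] with t ht
  rw [edgeMin_eq_neg_edgeMax, edgeMin_eq_neg_edgeMax, neg_add, ← smul_neg, ht, Pi.neg_apply]
  ring

theorem wNormSq_add_smul (f g : V → ℝ) (t : ℝ) :
    H.wNormSq (f + t • g) =
      H.wNormSq f + 2 * t * ∑ v, H.deg v * f v * g v + t ^ 2 * H.wNormSq g := by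
  simp only [wNormSq_eq_sum, Finset.mul_sum, ← Finset.sum_add_distrib, Pi.add_apply, Pi.smul_apply,
    smul_eq_mul]
  exact Finset.sum_congr rfl fun v _ => by ring

/-- First-order condition at a minimizer. -/
theorem first_order_le {γ : ℝ} {f g : V → ℝ} (c : H.edges → ℝ)
    (hle : ∀ h, γ * H.wNormSq h ≤ H.discEnergy h) (hf : H.discEnergy f = γ * H.wNormSq f)
    (hc : ∀ e, ∀ᶠ t : ℝ in 𝓝[>] 0, H.disc (f + t • g) e = H.disc f e + t * c e) :
    γ * ∑ v, H.deg v * f v * g v ≤ ∑ e : H.edges, H.weight e * H.disc f e * c e := by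
  set A := ∑ v, H.deg v * f v * g v
  set B := ∑ e : H.edges, H.weight e * H.disc f e * c e
  set C := ∑ e : H.edges, H.weight e * c e ^ 2
  -- Both sides of `γ‖h‖² ≤ Q(h)` at `h = f + t g` are quadratic in `t` with the same constant term;
  -- cancel it and divide by `t > 0`.
  have hev : ∀ᶠ t : ℝ in 𝓝[>] 0,
      2 * (γ * A) + t * (γ * H.wNormSq g) ≤ 2 * B + t * C := by
    filter_upwards [eventually_all.2 hc, self_mem_nhdsWithin] with t ht h0
    have h0 : 0 < t := h0
    have hE : H.discEnergy (f + t • g) = H.discEnergy f + 2 * t * B + t ^ 2 * C := by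
      simp only [discEnergy, ht, B, C, Finset.mul_sum, ← Finset.sum_add_distrib]
      exact Finset.sum_congr rfl fun e _ => by ring
    have h1 := hle (f + t • g)
    rw [hE, wNormSq_add_smul, hf] at h1
    refine le_of_mul_le_mul_left ?_ h0
    linarith
  have l1 : Tendsto (fun t : ℝ => 2 * (γ * A) + t * (γ * H.wNormSq g)) (𝓝[>] 0)
      (𝓝 (2 * (γ * A))) :=
    ((by fun_prop : Continuous fun t : ℝ => 2 * (γ * A) + t * (γ * H.wNormSq g)).tendsto' 0 _
      (by simp)).mono_left nhdsWithin_le_nhds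
  have l2 : Tendsto (fun t : ℝ => 2 * B + t * C) (𝓝[>] 0) (𝓝 (2 * B)) :=
    ((by fun_prop : Continuous fun t : ℝ => 2 * B + t * C).tendsto' 0 _
      (by simp)).mono_left nhdsWithin_le_nhds
  linarith [le_of_tendsto_of_tendsto l1 l2 hev]

/-! ### The diffusion at a minimizer -/

/-- Pairing the rate of change with a vector that is, where mass flows, constant on the maximal and
on the minimal sets. -/
theorem IsDiffusion.sum_deg_mul_rate {H : WeightedHypergraph V} {f r : V → ℝ}
    {rS rI : H.edges → V → ℝ} (h : H.IsDiffusion f r rS rI) (g : V → ℝ) (a b : H.edges → ℝ)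
    (ha : ∀ e, ∀ v ∈ H.maxSet f e, rS e v ≠ 0 → g v = a e)
    (hb : ∀ e, ∀ v ∈ H.minSet f e, rI e v ≠ 0 → g v = b e) :
    ∑ v, H.deg v * g v * r v = -∑ e : H.edges, H.weight e * H.disc f e * (a e + b e) := by
  -- Where `rS e` is nonzero, `g` is the constant `a e`, which factors out and leaves the total
  -- fixed by Rule 1.
  have hS : ∀ e, ∑ v, H.deg v * g v * rS e v = -(H.weight e * H.disc f e) * a e := by
    intro e
    rw [← h.total_S e, Finset.sum_mul]
    refine (Finset.sum_subset (Finset.subset_univ _) fun v _ hv => ?_).symm.trans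
      (Finset.sum_congr rfl fun v hv => ?_)
    · rw [h.supp_S e v hv, mul_zero]
    · by_cases h0 : rS e v = 0
      · simp [h0]
      · rw [ha e v hv h0]; ring
  have hI : ∀ e, ∑ v, H.deg v * g v * rI e v = -(H.weight e * H.disc f e) * b e := by
    intro e
    rw [← h.total_I e, Finset.sum_mul]
    refine (Finset.sum_subset (Finset.subset_univ _) fun v _ hv => ?_).symm.trans
      (Finset.sum_congr rfl fun v hv => ?_)
    · rw [h.supp_I e v hv, mul_zero]
    · by_cases h0 : rI e v = 0
      · simp [h0]
      · rw [hb e v hv h0]; ring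
  simp_rw [h.rate, Finset.mul_sum]
  rw [Finset.sum_comm, ← Finset.sum_neg_distrib]
  refine Finset.sum_congr rfl fun e _ => ?_
  simp_rw [mul_add, Finset.sum_add_distrib, hS, hI]
  ring

theorem isEigenpair_of_minimizer {γ : ℝ} {f : V → ℝ} (hf0 : H.wNormSq f ≠ 0)
    (hle : ∀ h, γ * H.wNormSq h ≤ H.discEnergy h) (hf : H.discEnergy f = γ * H.wNormSq f) :
    H.IsEigenpair γ f := by
  obtain ⟨rS, rI, h⟩ := H.rate_spec f
  set r := H.rate f
  choose s hs hsmax using fun e => (H.maxSet f e).exists_max_image r (H.maxSet_nonempty f e)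
  choose i hi himin using fun e => (H.minSet f e).exists_min_image r (H.minSet_nonempty f e)
  -- The minimizer is perturbed along the diffusion itself.
  have hfirst := H.first_order_le (g := r) (fun e => r (s e) + r (i e)) hle hf fun e => by
    filter_upwards [H.eventually_edgeMax_add_smul f r e (hs e) (hsmax e),
      H.eventually_edgeMin_add_smul f r e (hi e) (himin e)] with t h1 h2
    rw [disc, disc, h1, h2]
    ring
  -- Rule 2 enters here: for either sign of the discrepancy, mass flows only at vertices where `r`
  -- is maximal on `S_f(e)` or minimal on `I_f(e)`. The sum obtained is the one bounding `γ⟨f, r⟩`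
  -- in `hfirst`.
  have hrr := h.sum_deg_mul_rate r (fun e => r (s e)) (fun e => r (i e))
    (fun e v hv h0 => by
      rcases lt_trichotomy (H.disc f e) 0 with hc | hc | hc
      · exact h.neg_S e hc v hv h0 _ (hs e)
      · exact absurd (h.zero_S e hc v) h0
      · exact le_antisymm (hsmax e v hv) (h.pos_S e hc v hv h0 _ (hs e)))
    (fun e v hv h0 => by
      rcases lt_trichotomy (H.disc f e) 0 with hc | hc | hc
      · exact le_antisymm (h.neg_I e hc v hv h0 _ (hi e)) (himin e v hv)
      · exact absurd (h.zero_I e hc v) h0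
      · exact h.pos_I e hc v hv h0 _ (hi e))
  -- By definition `f` is constant on `S_f(e)` and on `I_f(e)`, so Rule 2 is not needed.
  have hfr := h.sum_deg_mul_rate f (H.edgeMax f) (H.edgeMin f)
    (fun e v hv _ => (Finset.mem_filter.1 hv).2) (fun e v hv _ => (Finset.mem_filter.1 hv).2)
  have hQ : ∑ e : H.edges, H.weight e * H.disc f e * (H.edgeMax f e + H.edgeMin f e) =
      γ * H.wNormSq f := by
    rw [← hf]
    exact Finset.sum_congr rfl fun e _ => by rw [← disc]; ring
  rw [hQ] at hfr
  have hr2 : H.wNormSq r = ∑ v, H.deg v * r v * r v := by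
    rw [wNormSq_eq_sum]
    exact Finset.sum_congr rfl fun v _ => by ring
  have hzero : H.wNormSq (r + γ • f) = 0 := by
    refine le_antisymm ?_ (H.wNormSq_nonneg _)
    have hcomm : ∑ v, H.deg v * r v * f v = ∑ v, H.deg v * f v * r v :=
      Finset.sum_congr rfl fun v _ => by ring
    rw [wNormSq_add_smul, hcomm, hr2, hrr, hfr]
    rw [hfr] at hfirst
    linarith
  refine ⟨hf0, ?_⟩
  funext v
  rw [wNormSq_eq_sum] at hzero
  have hv := (Finset.sum_eq_zero_iff_of_nonneg fun v _ =>
    mul_nonneg (H.deg_nonneg v) (sq_nonneg _)).1 hzero v (Finset.mem_univ v)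
  simp only [J, degMatrix, Matrix.mulVec_diagonal, Pi.neg_apply, Pi.smul_apply, smul_eq_mul]
  change -(H.deg v * r v) = _
  -- At an isolated vertex `r + γf` need not vanish, but the factor `deg(v)` kills both sides.
  rcases mul_eq_zero.1 hv with hv | hv
  · simp [hv]
  · have hv : r v + γ * f v = 0 := pow_eq_zero_iff two_ne_zero |>.1 hv
    linear_combination -H.deg v * hv

end WeightedHypergraph

theorem mainTheorem8 {V : Type*} [Fintype V] [DecidableEq V] (H : WeightedHypergraph V)
    (hE : H.edges.Nonempty) :
    ∃ γ₁ : ℝ,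
      IsLeast (H.discRatio '' {f : V → ℝ | H.wNormSq f ≠ 0}) γ₁ ∧
      H.IsEigenvalue γ₁ ∧
      ∀ f : V → ℝ, H.wNormSq f ≠ 0 → H.discRatio f = γ₁ → H.IsEigenpair γ₁ f := by
  obtain ⟨γ, hγ⟩ := H.exists_isLeast_discRatio hE
  -- Clearing the denominator extends the bound to vectors of norm zero, so perturbations need no
  -- nonvanishing check.
  have hle : ∀ h, γ * H.wNormSq h ≤ H.discEnergy h := by
    intro h
    by_cases h0 : H.wNormSq h = 0
    · rw [h0, mul_zero]
      exact H.discEnergy_nonneg h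
    · rw [← le_div_iff₀ ((H.wNormSq_nonneg h).lt_of_ne' h0)]
      exact hγ.2 ⟨h, h0, rfl⟩
  have hmin : ∀ f : V → ℝ, H.wNormSq f ≠ 0 → H.discRatio f = γ → H.IsEigenpair γ f :=
    fun f hf0 hf => H.isEigenpair_of_minimizer hf0 hle ((div_eq_iff hf0).1 hf)
  obtain ⟨f, hf0, hf⟩ := hγ.1
  exact ⟨γ, hγ, ⟨f, hmin f hf0 hf⟩, hmin⟩
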